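/- For a string $w$, let $z(w)$ be the number of phrases of its LZ77 factorization without self-references, $w=p_1\cdots p_z$, in which each non-empty phrase $p_i$, with its last character removed, is the longest prefix of $p_i\cdots p_z$ that occurs in $p_1\cdots p_{i-1}$; as an exception, the last phrase $p_z$ may itself occur in $p_1\cdots p_{z-1}$. Let $z'(w)$ be the number of phrases of its LZ-End factorization $w=q_1\cdots q_{z'}$, in which each non-empty phrase $q_i$, with its last character removed, is the longest prefix of $q_i\cdots q_{z'}$ that is a suffix of $q_1\cdots q_j$ for some $0\le j<i$; as an exception, the last phrase $q_{z'}$ may itself be a suffix of $q_1\cdots q_j$ for some $j<z'$. Let $S_k$ be the $k$-th period-doubling sequence over the alphabet $\{a,b\}$: $S_0=a$ and $S_{k+1}=\phi(S_k)$, where $\phi$ is the morphism $a\mapsto ab$, $b\mapsto aa$. Then: 1. $z(S_k)=k+1$ for all $k\ge 0$. 2. There is $f:\mathbb N\to\mathbb N$ with $f(k)=O(\log^* k)$ as $k\to\infty$ such that $z'(S_k)=2k-f(k)$ for all $k\ge 1$. Here $\log^*$ is the iterated binary logarithm. 3. Consequently $z'(S_k)/z(S_k)\to 2$ as $k\to\infty$,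 so there is a family of binary strings along which the ratio of LZ-End phrases to LZ77 phrases tends to $2$. 4. The alphabet size $2$ is the least possible: for every unary string $c^n$ the LZ77 and the LZ-End factorizations coincide, and hence there is no sequence of unary strings $w_m$ for which $z'(w_m)/z(w_m)\to 2$. -/

import Mathlib

open Filter Topology Asymptotics

namespace LZ

/-! ### Greedy left-to-right factorizations -/

section Factorization

variable {α : Type*}

/-- `u` is the longest prefix of `t` that has the property `P`. -/
def IsLongestPrefix (P : List α → Prop) (t u : List α) : Prop :=
  u <+: t ∧ P u ∧ ∀ v, v <+: t → P v → v.length ≤ u.length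

/-- The list `p` of phrases is a factorization of `w` into non-empty phrases such that, for each
phrase `x` preceded by the phrases `pre` and followed by the phrases `post`, either `x` without its
last character is the longest prefix of the remaining text `x ++ post.flatten` that is an admissible
source with respect to `pre`, or `x` is the last phrase and is itself an admissible source. -/
def IsGreedyFactorization (Source : List (List α) → List α → Prop)
    (w : List α) (p : List (List α)) : Prop :=
  p.flatten = w ∧ ∀ pre x post, p = pre ++ x :: post →
    x ≠ [] ∧ (IsLongestPrefix (Source pre) (x ++ post.flatten) x.dropLast ∨
      (post = [] ∧ Source pre x))

/-- Sources for LZ77 (without self-references): strings occurring in the text parsed so far. -/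
def LZ77Source (pre : List (List α)) (u : List α) : Prop :=
  u <:+: pre.flatten

/-- Sources for LZ-End: strings occurring as a suffix of the concatenation of the first `j` phrases,
for some `j` at most the number of phrases parsed so far. -/
def LZEndSource (pre : List (List α)) (u : List α) : Prop :=
  ∃ j ≤ pre.length, u <:+ (pre.take j).flatten

/-- `p` is an LZ77 factorization of `w`. -/
def IsLZ77Factorization (w : List α) (p : List (List α)) : Prop :=
  IsGreedyFactorization LZ77Source w p

/-- `p` is an LZ-End factorization of `w`. -/
def IsLZEndFactorization (w : List α) (p : List (List α)) : Prop :=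
  IsGreedyFactorization LZEndSource w p

/-- Every string has a longest prefix with a property that the empty string has. -/
theorem exists_isLongestPrefix (P : List α → Prop) (h : P []) (t : List α) :
    ∃ u, IsLongestPrefix P t u := by
  classical
  let Q : ℕ → Prop := fun n => P (t.take n)
  have h0 : Q 0 := by simpa [Q] using h
  refine ⟨t.take (Nat.findGreatest Q t.length), List.take_prefix _ _,
    Nat.findGreatest_spec (P := Q) (Nat.zero_le _) h0, ?_⟩
  intro v hv hP
  have hl := hv.length_le
  have hv' : v = t.take v.length := List.prefix_iff_eq_take.1 hv
  have hq : Q v.length := by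
    show P (t.take v.length)
    rw [← hv']
    exact hP
  have := Nat.le_findGreatest hl hq
  have h2 := Nat.findGreatest_le (P := Q) t.length
  simp only [List.length_take]
  omega

theorem exists_greedy_aux (Source : List (List α) → List α → Prop) (h : ∀ pre, Source pre []) :
    ∀ (n : ℕ) (pre0 : List (List α)) (t : List α), t.length ≤ n →
      ∃ p : List (List α), p.flatten = t ∧ ∀ pre x post, p = pre ++ x :: post →
        x ≠ [] ∧ (IsLongestPrefix (Source (pre0 ++ pre)) (x ++ post.flatten) x.dropLast ∨
          (post = [] ∧ Source (pre0 ++ pre) x)) := by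
  intro n
  induction n with
  | zero =>
    intro pre0 t ht
    exact ⟨[], by simpa using (List.length_eq_zero_iff.1 (Nat.le_zero.1 ht)).symm, by simp⟩
  | succ n ih =>
    intro pre0 t ht
    rcases eq_or_ne t [] with rfl | hne
    · exact ⟨[], by simp, by simp⟩
    obtain ⟨u, hu⟩ := exists_isLongestPrefix (Source pre0) (h pre0) t
    obtain ⟨s, rfl⟩ := hu.1
    cases s with
    | nil =>
      refine ⟨[u], by simp, ?_⟩
      intro pre x post hp
      cases pre with
      | nil =>
        simp only [List.nil_append, List.cons.injEq] at hp
        obtain ⟨rfl, rfl⟩ := hp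
        exact ⟨by simpa using hne, Or.inr ⟨rfl, by simpa using hu.2.1⟩⟩
      | cons y pre => simp at hp
    | cons c s =>
      obtain ⟨p, hp, hg⟩ := ih (pre0 ++ [u ++ [c]]) s (by simp at ht; omega)
      refine ⟨(u ++ [c]) :: p, by simp [hp], ?_⟩
      intro pre x post he
      cases pre with
      | nil =>
        simp only [List.nil_append, List.cons.injEq] at he
        obtain ⟨rfl, rfl⟩ := he
        refine ⟨by simp, Or.inl ?_⟩
        simpa [hp] using hu
      | cons y pre =>
        simp only [List.cons_append, List.cons.injEq] at he
        obtain ⟨rfl, he⟩ := he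
        simpa using hg pre x post he

theorem greedy_unique_aux (Source : List (List α) → List α → Prop) :
    ∀ (p q pre0 : List (List α)), p.flatten = q.flatten →
      (∀ pre x post, p = pre ++ x :: post →
        x ≠ [] ∧ (IsLongestPrefix (Source (pre0 ++ pre)) (x ++ post.flatten) x.dropLast ∨
          (post = [] ∧ Source (pre0 ++ pre) x))) →
      (∀ pre x post, q = pre ++ x :: post →
        x ≠ [] ∧ (IsLongestPrefix (Source (pre0 ++ pre)) (x ++ post.flatten) x.dropLast ∨
          (post = [] ∧ Source (pre0 ++ pre) x))) → p = q := by
  intro p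
  induction p with
  | nil =>
    intro q pre0 hf _ hq
    cases q with
    | nil => rfl
    | cons y q => exact absurd (by simp at hf; exact hf.1) (hq [] y q rfl).1
  | cons x p ih =>
    intro q pre0 hf hp hq
    cases q with
    | nil => exact absurd (by simp at hf; exact hf.1) (hp [] x p rfl).1
    | cons y q =>
      have hf' : x ++ p.flatten = y ++ q.flatten := by simpa using hf
      obtain ⟨hx, hx'⟩ := hp [] x p rfl
      obtain ⟨hy, hy'⟩ := hq [] y q rfl
      have lx := List.length_pos_iff.2 hx
      have ly := List.length_pos_iff.2 hy
      have hlen := congrArg List.length hf'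
      simp only [List.length_append] at hlen
      have key : x.length = y.length := by
        rcases hx' with hx' | ⟨rfl, hx'⟩ <;> rcases hy' with hy' | ⟨rfl, hy'⟩
        · have h1 := hx'.2.2 _ (hf' ▸ hy'.1) hy'.2.1
          have h2 := hy'.2.2 _ (hf' ▸ hx'.1) hx'.2.1
          simp only [List.length_dropLast] at h1 h2
          omega
        · have h1 := hx'.2.2 y (hf' ▸ List.prefix_append _ _) hy'
          simp only [List.length_dropLast] at h1
          simp at hlen
          omega
        · have h1 := hy'.2.2 x (hf' ▸ List.prefix_append _ _) hx'
          simp only [List.length_dropLast] at h1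
          simp at hlen
          omega
        · simpa using hlen
      obtain ⟨rfl, hr⟩ := List.append_inj hf' key
      congr 1
      refine ih q (pre0 ++ [x]) hr ?_ ?_
      · intro pre z post he
        simpa using hp (x :: pre) z post (by simp [he])
      · intro pre z post he
        simpa using hq (x :: pre) z post (by simp [he])

theorem existsUnique_greedy (Source : List (List α) → List α → Prop) (h : ∀ pre, Source pre [])
    (w : List α) : ∃! p, IsGreedyFactorization Source w p := by
  obtain ⟨p, hp, hg⟩ := exists_greedy_aux Source h w.length [] w le_rfl
  refine ⟨p, ⟨hp, by simpa using hg⟩, ?_⟩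
  rintro q ⟨hq, hg'⟩
  exact greedy_unique_aux Source q p [] (hq.trans hp.symm) (by simpa using hg') (by simpa using hg)

theorem existsUnique_lz77 (w : List α) : ∃! p, IsLZ77Factorization w p :=
  existsUnique_greedy LZ77Source (fun pre => List.nil_infix (l := pre.flatten)) w

theorem existsUnique_lzEnd (w : List α) : ∃! p, IsLZEndFactorization w p :=
  existsUnique_greedy LZEndSource (fun _ => ⟨0, Nat.zero_le _, List.nil_suffix⟩) w

/-- The LZ77 factorization of `w` (the unique one). -/
noncomputable def lz77 (w : List α) : List (List α) := (existsUnique_lz77 w).choose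

/-- The LZ-End factorization of `w` (the unique one). -/
noncomputable def lzEnd (w : List α) : List (List α) := (existsUnique_lzEnd w).choose

theorem lz77_eq_iff {w : List α} {p : List (List α)} :
    lz77 w = p ↔ IsLZ77Factorization w p :=
  ⟨fun h => h ▸ (existsUnique_lz77 w).choose_spec.1,
    fun h => ((existsUnique_lz77 w).choose_spec.2 p h).symm⟩

theorem lzEnd_eq_iff {w : List α} {p : List (List α)} :
    lzEnd w = p ↔ IsLZEndFactorization w p :=
  ⟨fun h => h ▸ (existsUnique_lzEnd w).choose_spec.1,
    fun h => ((existsUnique_lzEnd w).choose_spec.2 p h).symm⟩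

/-- The number of LZ77 phrases of `w`. -/
noncomputable def numLZ77 (w : List α) : ℕ := (lz77 w).length

/-- The number of LZ-End phrases of `w`. -/
noncomputable def numLZEnd (w : List α) : ℕ := (lzEnd w).length

end Factorization

/-! ### Period-doubling sequences, over the binary alphabet `a = false`, `b = true` -/

/-- The images of the letters under the period-doubling morphism: `a ↦ ab`, `b ↦ aa`. -/
def pdLetter : Bool → List Bool
  | false => [false, true]
  | true => [false, false]

/-- The `k`-th period-doubling sequence: `S 0 = a`, and `S (k + 1)` is the image of `S k` under the
morphism `a ↦ ab`, `b ↦ aa`. -/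
def periodDoubling : ℕ → List Bool
  | 0 => [false]
  | k + 1 => (periodDoubling k).flatMap pdLetter

/-- The equivalent recursion: `S (k + 1)` is `S k` followed by `S k` with its last letter
flipped. -/
theorem periodDoubling_succ (k : ℕ) : ∃ u c, periodDoubling k = u ++ [c] ∧
    periodDoubling (k + 1) = (u ++ [c]) ++ (u ++ [!c]) := by
  induction k with
  | zero => exact ⟨[], false, rfl, rfl⟩
  | succ k ih =>
    obtain ⟨u, c, h1, h2⟩ := ih
    refine ⟨u ++ [c] ++ u, !c, by simp [h2], ?_⟩
    have h3 : periodDoubling (k + 1) = (u ++ [c]).flatMap pdLetter := by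
      rw [← h1]; rfl
    have h4 : periodDoubling (k + 2) = (periodDoubling (k + 1)).flatMap pdLetter := rfl
    rw [h4, h2, List.flatMap_append, ← h3, h2]
    have h5 : u.flatMap pdLetter ++ pdLetter c = u ++ [c] ++ u ++ [!c] := by
      have := h3.symm.trans h2
      simpa using this
    have h6 : (u ++ [!c]).flatMap pdLetter = u.flatMap pdLetter ++ pdLetter (!c) := by simp
    rw [h6]
    cases c <;> simp only [pdLetter, Bool.not_false, Bool.not_true] at h5 ⊢
    · have : u.flatMap pdLetter ++ [false] = u ++ [false] ++ u := by
        have h7 : (u.flatMap pdLetter ++ [false]) ++ [true] = (u ++ [false] ++ u) ++ [true] := by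
          simpa using h5
        exact List.append_cancel_right h7
      have h8 : u.flatMap pdLetter ++ [false, false] =
          (u.flatMap pdLetter ++ [false]) ++ [false] := by simp
      rw [h8, this]
      simp
    · have : u.flatMap pdLetter ++ [false] = u ++ [true] ++ u := by
        have h7 : (u.flatMap pdLetter ++ [false]) ++ [false] = (u ++ [true] ++ u) ++ [false] := by
          simpa using h5
        exact List.append_cancel_right h7
      have h8 : u.flatMap pdLetter ++ [false, true] =
          (u.flatMap pdLetter ++ [false]) ++ [true] := by simp
      rw [h8, this]
      simp

/-! ### The iterated logarithm -/

/-- The iterated logarithm `log* x`: the least number of times that the binary logarithm has to be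
applied to `x` to reach a value at most `1`. -/
noncomputable def logStar (x : ℝ) : ℕ :=
  sInf {i : ℕ | (Real.logb 2)^[i] x ≤ 1}

theorem logStar_nonempty (x : ℝ) : {i : ℕ | (Real.logb 2)^[i] x ≤ 1}.Nonempty := by
  have key : ∀ (n : ℕ) (x : ℝ), x ≤ n + 1 → ∃ i : ℕ, (Real.logb 2)^[i] x ≤ 1 := by
    intro n
    induction n with
    | zero => intro x hx; exact ⟨0, by simpa using hx⟩
    | succ n ih =>
      intro x hx
      rcases le_or_gt x 1 with h1 | h1
      · exact ⟨0, by simpa using h1⟩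
      · have hlog : Real.logb 2 x ≤ (n : ℝ) + 1 := by
          rw [Real.logb_le_iff_le_rpow (by norm_num) (by linarith)]
          have h2 : (n + 1 : ℕ) + 1 ≤ 2 ^ (n + 1) := Nat.lt_two_pow_self
          have h3 : ((n + 1 : ℕ) : ℝ) + 1 ≤ 2 ^ (n + 1) := by exact_mod_cast h2
          have h4 : (2 : ℝ) ^ ((n : ℝ) + 1) = 2 ^ (n + 1) := by
            rw [← Real.rpow_natCast]; push_cast; rfl
          rw [h4]; linarith
        obtain ⟨i, hi⟩ := ih _ hlog
        exact ⟨i + 1, by simpa using hi⟩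
  obtain ⟨n, hn⟩ := exists_nat_ge x
  exact key n x (by linarith)

end LZ

namespace LZ

/-! ### The infinite period-doubling word -/

/-! The letter at position x of the infinite period-doubling word is the parity of the 2-adic
valuation of x, and S_k is its prefix of length 2^k. Both factorizations are read off from greedy
parsings of this infinite word, recorded by their phrase ends (`Parse`), up to a last phrase cut off
at 2^k.

LZ77: the second half of S_{k+1} repeats the first except in its last letter, so the phrase ends are
the powers of two.

LZ-End: a match with shift 2^a * o, o odd, breaks at each multiple 2^a * y with y in one of two
residue classes mod 4, so it is shorter than 3 * 2^a (`Match.exists_shift`); up to scaling, this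
leaves finitely many shifts to exclude per phrase. Suppose that consecutive phrases end at 5 * 2^m
and 8 * 2^m. The next one ends at 13 * 2^m + 1, short of 16 * 2^m by 3 * 2^m - 1. From then on each
doubling costs exactly two phrases and shrinks this miss by one (`parse_epoch`). When the miss
reaches 0 the initial situation recurs, with m + 3 * 2^m in place of m. Each such epoch has a single
one-phrase doubling, so the deficit against 2k grows by one per epoch; the epochs grow like a tower
of exponentials, hence the deficit is O(log* k).

Unary strings: every factor of the parsed text is also a suffix of it, so the two kinds of source
agree. -/

/-- The letter at position `x ≥ 1` of the infinite period-doubling word. -/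
def pdChar (x : ℕ) : Bool := decide (Odd (padicValNat 2 x))

theorem pdChar_two_pow_mul (a : ℕ) {o : ℕ} (ho : o % 2 = 1) :
    pdChar (2 ^ a * o) = decide (Odd a) := by
  have h0 : o ≠ 0 := by omega
  have h1 : padicValNat 2 o = 0 := padicValNat.eq_zero_of_not_dvd (by omega)
  simp [pdChar, padicValNat.mul, h0, h1]

theorem pdChar_odd {o : ℕ} (ho : o % 2 = 1) : pdChar o = false := by
  simpa using pdChar_two_pow_mul 0 ho

theorem exists_two_pow_mul_odd {x : ℕ} (hx : x ≠ 0) :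
    ∃ a o, x = 2 ^ a * o ∧ o % 2 = 1 := by
  obtain ⟨a, o, ho, h⟩ := Nat.exists_eq_two_pow_mul_odd hx
  exact ⟨a, o, h, Nat.odd_iff.1 ho⟩

theorem pdChar_two_mul {x : ℕ} (hx : x ≠ 0) : pdChar (2 * x) = !pdChar x := by
  obtain ⟨a, o, rfl, ho⟩ := exists_two_pow_mul_odd hx
  rw [← mul_assoc, ← pow_succ', pdChar_two_pow_mul _ ho, pdChar_two_pow_mul _ ho]
  simp [Nat.even_add_one, ← Nat.not_even_iff_odd]

theorem pdChar_add_two_pow {a x : ℕ} (h : ¬ 2 ^ a ∣ x) : pdChar (x + 2 ^ a) = pdChar x := by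
  obtain ⟨b, o, rfl, ho⟩ := exists_two_pow_mul_odd (x := x) (by rintro rfl; simp at h)
  have hb : b < a := by
    by_contra hb
    exact h ((pow_dvd_pow 2 (not_lt.1 hb)).mul_right o)
  obtain ⟨d, rfl⟩ := Nat.exists_eq_add_of_lt hb
  have : 2 ^ b * o + 2 ^ (b + d + 1) = 2 ^ b * (o + 2 * 2 ^ d) := by ring
  rw [this, pdChar_two_pow_mul _ ho, pdChar_two_pow_mul _ (by omega)]

/-- Since v(x) < a, the numbers x and 2^a - x have the same valuation: S_a without its last letter
is a palindrome. -/
theorem pdChar_two_pow_sub {a x : ℕ} (h0 : 0 < x) (h : x < 2 ^ a) :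
    pdChar (2 ^ a - x) = pdChar x := by
  obtain ⟨b, o, rfl, ho⟩ := exists_two_pow_mul_odd h0.ne'
  have hb : b < a := by
    by_contra hb
    have h1 : 2 ^ a ≤ 2 ^ b := Nat.pow_le_pow_right (by norm_num) (not_lt.1 hb)
    have h2 : 2 ^ b * 1 ≤ 2 ^ b * o := Nat.mul_le_mul_left _ (by omega)
    omega
  obtain ⟨d, rfl⟩ := Nat.exists_eq_add_of_lt hb
  have e : 2 ^ (b + d + 1) = 2 ^ b * (2 * 2 ^ d) := by ring
  rw [e] at h ⊢
  have := Nat.lt_of_mul_lt_mul_left h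
  rw [← Nat.mul_sub, pdChar_two_pow_mul _ ho, pdChar_two_pow_mul _ (by omega)]

/-- One of y and y - o is 2 mod 4 and the other is odd, so the two valuations are a and a + 1. -/
theorem pdChar_ne_of_mod {a o y : ℕ} (ho : o % 2 = 1) (hy : o < y)
    (h : y % 4 = 2 ∨ y % 4 = (o + 2) % 4) : pdChar (2 ^ a * y) ≠ pdChar (2 ^ a * (y - o)) := by
  rcases h with h | h
  · obtain ⟨z, rfl⟩ : ∃ z, y = 2 * z := ⟨y / 2, by omega⟩
    rw [← mul_assoc, ← pow_succ, pdChar_two_pow_mul _ (by omega), pdChar_two_pow_mul _ (by omega)]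
    simp [Nat.even_add_one, ← Nat.not_even_iff_odd]
  · obtain ⟨z, hz⟩ : ∃ z, y - o = 2 * z := ⟨(y - o) / 2, by omega⟩
    rw [hz, ← mul_assoc, ← pow_succ, pdChar_two_pow_mul _ (by omega),
      pdChar_two_pow_mul _ (by omega)]
    simp [Nat.even_add_one, ← Nat.not_even_iff_odd]

/-- The factor of the infinite period-doubling word at the positions `x` with `p < x ≤ n`. -/
def seg (p n : ℕ) : List Bool := (List.range' (p + 1) (n - p)).map pdChar

@[simp] theorem length_seg (p n : ℕ) : (seg p n).length = n - p := by simp [seg]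

@[simp] theorem seg_self (p : ℕ) : seg p p = [] := by simp [seg]

theorem seg_append {p q n : ℕ} (h1 : p ≤ q) (h2 : q ≤ n) : seg p q ++ seg q n = seg p n := by
  obtain ⟨i, rfl⟩ := Nat.exists_eq_add_of_le h1
  obtain ⟨j, rfl⟩ := Nat.exists_eq_add_of_le h2
  have e : p + i + j - p = i + j := by omega
  simp only [seg, ← List.map_append, Nat.add_sub_cancel_left, e]
  rw [← List.range'_append_1]
  congr 3
  omega

theorem seg_succ {p n : ℕ} (h : p ≤ n) : seg p (n + 1) = seg p n ++ [pdChar (n + 1)] := by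
  rw [← seg_append h n.le_succ]
  simp [seg]

theorem seg_prefix {p q n : ℕ} (h1 : p ≤ q) (h2 : q ≤ n) : seg p q <+: seg p n :=
  ⟨_, seg_append h1 h2⟩

theorem dropLast_seg {p n : ℕ} (h : p < n) : (seg p n).dropLast = seg p (n - 1) := by
  obtain ⟨m, rfl⟩ := Nat.exists_eq_add_of_lt h
  rw [seg_succ (by omega)]
  simp

theorem eq_seg_of_prefix {p n : ℕ} {v : List Bool} (h : p ≤ n) (hv : v <+: seg p n) :
    v = seg p (p + v.length) := by
  have hl := hv.length_le
  rw [length_seg] at hl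
  refine (List.prefix_of_prefix_length_le hv
    (seg_prefix (q := p + v.length) (by omega) (by omega)) (by simp)).eq_of_length (by simp)

theorem seg_two_mul (m : ℕ) : seg 0 (2 * m) = (seg 0 m).flatMap pdLetter := by
  induction m with
  | zero => simp
  | succ m ih =>
    rw [show 2 * (m + 1) = 2 * m + 1 + 1 by ring, seg_succ (by omega), seg_succ (by omega),
      seg_succ (by omega), ih, List.flatMap_append, show 2 * m + 1 + 1 = 2 * (m + 1) by ring,
      pdChar_two_mul (by omega), pdChar_odd (by omega)]
    cases pdChar (m + 1) <;> simp [pdLetter]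

theorem periodDoubling_eq_seg (k : ℕ) : periodDoubling k = seg 0 (2 ^ k) := by
  induction k with
  | zero => simp [periodDoubling, seg, pdChar]
  | succ k ih => rw [pow_succ', seg_two_mul, ← ih]; rfl

theorem seg_eq_seg {p n q r : ℕ} (h : n - p = r - q) :
    seg p n = seg q r ↔ ∀ i < n - p, pdChar (p + 1 + i) = pdChar (q + 1 + i) := by
  constructor
  · intro he i hi
    have := List.getElem_of_eq he (i := i) (by simpa using hi)
    simpa [seg] using this
  · intro he
    refine List.ext_getElem (by simpa using h) ?_
    intro i h1 h2
    have := he i (by simpa using h1)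
    simpa [seg] using this

/-- The factor `seg p n` is a suffix of the prefix of length `e` of the infinite word. -/
def Match (p n e : ℕ) : Prop :=
  n - p ≤ e ∧ ∀ i < n - p, pdChar (p + 1 + i) = pdChar (e - (n - p) + 1 + i)

theorem seg_suffix_iff {p n e : ℕ} : seg p n <:+ seg 0 e ↔ Match p n e := by
  have key : n - p ≤ e → (seg p n <:+ seg 0 e ↔ seg p n = seg (e - (n - p)) e) := by
    intro hl
    have h2 : seg (e - (n - p)) e <:+ seg 0 e := ⟨_, seg_append (by omega) (by omega)⟩
    have h3 : (seg p n).length = (seg (e - (n - p)) e).length := by simp; omega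
    constructor
    · intro h
      exact (List.suffix_of_suffix_length_le h h2 h3.le).eq_of_length h3
    · intro h; rwa [h]
  constructor
  · intro h
    have hl : n - p ≤ e := by simpa using h.length_le
    exact ⟨hl, (seg_eq_seg (by omega)).1 ((key hl).1 h)⟩
  · rintro ⟨hl, h⟩
    exact (key hl).2 ((seg_eq_seg (by omega)).2 h)

/-- The positions at which a match with a shift `2 ^ a * o`, with `o` odd, is impossible. -/
theorem Match.exists_shift {p n e : ℕ} (h : Match p n e) (he : e < n) :
    ∃ a o, n = e + 2 ^ a * o ∧ o % 2 = 1 ∧ n < p + 3 * 2 ^ a ∧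
      ∀ y, p < 2 ^ a * y → 2 ^ a * y ≤ n → y % 4 ≠ 2 ∧ y % 4 ≠ (o + 2) % 4 := by
  obtain ⟨a, o, hq, ho⟩ := exists_two_pow_mul_odd (x := n - e) (by omega)
  obtain ⟨hl, h⟩ := h
  have key : ∀ y, p < 2 ^ a * y → 2 ^ a * y ≤ n → y % 4 ≠ 2 ∧ y % 4 ≠ (o + 2) % 4 := by
    intro y h1 h2
    rw [← not_or]
    intro hy
    have h3 := h (2 ^ a * y - p - 1) (by omega)
    have h4 : o < y := by
      apply Nat.lt_of_mul_lt_mul_left (a := 2 ^ a)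
      omega
    apply pdChar_ne_of_mod (a := a) ho h4 hy
    rw [Nat.mul_sub, ← hq]
    convert h3 using 2 <;> omega
  refine ⟨a, o, by omega, ho, ?_, key⟩
  -- Only the residues 0 and o mod 4 are allowed for y, and no three consecutive integers avoid the
  -- other two classes.
  by_contra hlt
  have hpos : 0 < 2 ^ a := by positivity
  have hdiv := Nat.div_add_mod p (2 ^ a)
  have hmod := Nat.mod_lt p hpos
  generalize p / 2 ^ a = y at hdiv
  have e1 : 2 ^ a * (y + 1) = 2 ^ a * y + 2 ^ a := by ring
  have e2 : 2 ^ a * (y + 2) = 2 ^ a * y + 2 * 2 ^ a := by ring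
  have e3 : 2 ^ a * (y + 3) = 2 ^ a * y + 3 * 2 ^ a := by ring
  have k1 := key (y + 1) (by omega) (by omega)
  have k2 := key (y + 2) (by omega) (by omega)
  have k3 := key (y + 3) (by omega) (by omega)
  omega

/-! ### The matches of the period-doubling word that determine its LZ-End phrases -/

theorem exists_add_of_two_pow_lt {a m i j : ℕ} (h1 : 2 ^ (m + i) < 2 ^ (a + 1))
    (h2 : 2 ^ a < 2 ^ (m + j)) : ∃ d, i ≤ d ∧ d < j ∧ a = m + d := by
  have h1 := (Nat.pow_lt_pow_iff_right (by norm_num)).1 h1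
  have h2 := (Nat.pow_lt_pow_iff_right (by norm_num)).1 h2
  exact ⟨a - m, by omega, by omega, by omega⟩

/-- Maximality of the first phrase of a doubling. The cases for e cover all phrase ends available
then; e = 8 * 2^m occurs only at the start of an epoch. -/
theorem not_match_of_lower {m δ n e : ℕ} (h1 : 1 ≤ δ) (h2 : δ < 3 * 2 ^ m)
    (hn : 20 * 2 ^ m < n + δ)
    (he : e = 16 * 2 ^ m - δ ∨ e = 8 * 2 ^ m ∨ (e = 10 * 2 ^ m - δ ∧ δ < 2 * 2 ^ m) ∨
      e + δ < 8 * 2 ^ m) :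
    ¬ Match (16 * 2 ^ m - δ) n e := by
  intro h
  have hl := h.1
  obtain ⟨a, o, hq, ho, h3, key⟩ := h.exists_shift (by omega)
  have hb : 2 ^ a * 1 ≤ 2 ^ a * o := Nat.mul_le_mul_left _ (by omega)
  -- The length exceeds 4 * 2^m and is below 3 * 2^a, which bounds a from below. The source starts
  -- at a nonnegative position, so the shift is at most the start of the phrase, which bounds a from
  -- above.
  obtain ⟨d, hd1, hd2, rfl⟩ := exists_add_of_two_pow_lt (a := a) (m := m) (i := 1) (j := 5)
    (by rw [pow_add, pow_succ 2 a]; omega) (by rw [pow_add]; omega)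
  rw [pow_add] at hq h3 key hb
  generalize 2 ^ m = Q at *
  have hQ : 0 < Q := by omega
  interval_cases d <;> norm_num at hq h3 key hb
  -- For each scale few odd o remain; each is refuted by a forbidden multiple inside the phrase or
  -- by the position of e.
  · have ho2 : o < 16 := Nat.lt_of_mul_lt_mul_left (a := Q * 2) (by omega)
    have k1 := key 7
    have k2 := key 8
    have k3 := key 9
    have k4 := key 10
    clear key
    interval_cases o <;> omega
  · have ho2 : o < 8 := Nat.lt_of_mul_lt_mul_left (a := Q * 4) (by omega)
    have k1 := key 4
    have k2 := key 5
    have k3 := key 6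
    clear key
    interval_cases o <;> omega
  · have ho2 : o < 4 := Nat.lt_of_mul_lt_mul_left (a := Q * 8) (by omega)
    have k1 := key 2
    clear key
    interval_cases o <;> omega
  · have ho2 : o < 2 := Nat.lt_of_mul_lt_mul_left (a := Q * 16) (by omega)
    clear key
    interval_cases o <;> omega

/-- Maximality of the second phrase of a doubling, by the same exclusion of shifts. -/
theorem not_match_of_upper {m δ n e : ℕ} (h2 : δ + 1 < 3 * 2 ^ m)
    (hn : 32 * 2 ^ m ≤ n + δ) (he : e = 20 * 2 ^ m - δ ∨ e + δ < 16 * 2 ^ m) :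
    ¬ Match (20 * 2 ^ m - δ) n e := by
  intro h
  have hl := h.1
  obtain ⟨a, o, hq, ho, h3, key⟩ := h.exists_shift (by omega)
  have hb : 2 ^ a * 1 ≤ 2 ^ a * o := Nat.mul_le_mul_left _ (by omega)
  obtain ⟨d, hd1, hd2, rfl⟩ := exists_add_of_two_pow_lt (a := a) (m := m) (i := 3) (j := 6)
    (by rw [pow_add, pow_succ 2 a]; omega) (by rw [pow_add]; omega)
  rw [pow_add] at hq h3 key hb
  generalize 2 ^ m = Q at *
  have hQ : 0 < Q := by omega
  interval_cases d <;> norm_num at hq h3 key hb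
  · have ho2 : o < 6 := Nat.lt_of_mul_lt_mul_left (a := Q * 8) (by omega)
    have k1 := key 3
    have k2 := key 4
    have k3 := key 5
    clear key
    interval_cases o <;> omega
  · have ho2 : o < 3 := Nat.lt_of_mul_lt_mul_left (a := Q * 16) (by omega)
    have k1 := key 2
    clear key
    interval_cases o <;> omega
  · have ho2 : o < 2 := Nat.lt_of_mul_lt_mul_left (a := Q * 32) (by omega)
    clear key
    interval_cases o <;> omega

theorem not_match_of_pow {m n e : ℕ} (hn : 13 * 2 ^ m < n)
    (he : e = 8 * 2 ^ m ∨ e ≤ 5 * 2 ^ m) : ¬ Match (8 * 2 ^ m) n e := by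
  intro h
  have hl := h.1
  obtain ⟨a, o, hq, ho, h3, key⟩ := h.exists_shift (by omega)
  have hb : 2 ^ a * 1 ≤ 2 ^ a * o := Nat.mul_le_mul_left _ (by omega)
  obtain ⟨d, hd1, hd2, rfl⟩ := exists_add_of_two_pow_lt (a := a) (m := m) (i := 1) (j := 5)
    (by rw [pow_add, pow_succ 2 a]; omega) (by rw [pow_add]; omega)
  rw [pow_add] at hq h3 key hb
  generalize 2 ^ m = Q at *
  interval_cases d <;> norm_num at hq h3 key hb
  · have k1 := key 6
    omega
  · have ho2 : o < 4 := Nat.lt_of_mul_lt_mul_left (a := Q * 4) (by omega)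
    have k1 := key 3
    clear key
    interval_cases o <;> omega
  · have ho2 : o < 2 := Nat.lt_of_mul_lt_mul_left (a := Q * 8) (by omega)
    have k1 := key 2
    clear key
    interval_cases o <;> omega
  · omega

/-- The shift is 4 * 2^m. The only source position divisible by it is 12 * 2^m, which goes to 16 *
2^m: the valuations differ by 2, so the letters agree. -/
theorem match_of_lower {m δ : ℕ} (h0 : 1 ≤ δ) (h : δ < 4 * 2 ^ m) :
    Match (16 * 2 ^ m - δ) (20 * 2 ^ m - δ) (16 * 2 ^ m - δ) := by
  refine ⟨by omega, fun i hi => ?_⟩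
  have h4 : 2 ^ (m + 2) = 4 * 2 ^ m := by ring
  obtain ⟨x, hx⟩ : ∃ x, x = 16 * 2 ^ m - δ - (20 * 2 ^ m - δ - (16 * 2 ^ m - δ)) + 1 + i := ⟨_, rfl⟩
  rw [← hx, show 16 * 2 ^ m - δ + 1 + i = x + 2 ^ (m + 2) by omega]
  by_cases hd : 2 ^ (m + 2) ∣ x
  · obtain ⟨y, rfl⟩ := hd
    have h5 : 2 < y := Nat.lt_of_mul_lt_mul_left (a := 2 ^ (m + 2)) (by omega)
    have h6 : y < 4 := Nat.lt_of_mul_lt_mul_left (a := 2 ^ (m + 2)) (by omega)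
    obtain rfl : y = 3 := by omega
    rw [show 2 ^ (m + 2) * 3 + 2 ^ (m + 2) = 2 ^ (m + 2 + 2) * 1 by ring,
      pdChar_two_pow_mul _ rfl, pdChar_two_pow_mul _ rfl]
    simp [Nat.even_add_one, ← Nat.not_even_iff_odd]
  · exact pdChar_add_two_pow hd

/-- The shift is 16 * 2^m and every source position lies strictly below it, so valuations are kept.
-/
theorem match_of_upper {m δ : ℕ} (h : δ + 1 < 4 * 2 ^ m) :
    Match (20 * 2 ^ m - δ) (32 * 2 ^ m - δ - 1) (16 * 2 ^ m - δ - 1) := by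
  refine ⟨by omega, fun i hi => ?_⟩
  have h4 : 2 ^ (m + 4) = 16 * 2 ^ m := by ring
  rw [show 20 * 2 ^ m - δ + 1 + i = 4 * 2 ^ m - δ + 1 + i + 2 ^ (m + 4) by omega,
    pdChar_add_two_pow (Nat.not_dvd_of_pos_of_lt (by omega) (by omega))]
  congr 1
  omega

theorem match_of_pow (m : ℕ) : Match (8 * 2 ^ m) (13 * 2 ^ m) (5 * 2 ^ m) := by
  refine ⟨by omega, fun i hi => ?_⟩
  have h4 : 2 ^ (m + 3) = 8 * 2 ^ m := by ring
  rw [show 8 * 2 ^ m + 1 + i = 1 + i + 2 ^ (m + 3) by omega,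
    pdChar_add_two_pow (Nat.not_dvd_of_pos_of_lt (by omega) (by omega))]
  congr 1
  omega

theorem match_two_pow_sub {a b δ : ℕ} (h0 : 1 ≤ δ) (ha : δ ≤ 2 ^ a) (hb : δ ≤ 2 ^ b) :
    Match (2 ^ a - δ) (2 ^ a - 1) (2 ^ b - 1) := by
  refine ⟨by omega, fun i hi => ?_⟩
  rw [show 2 ^ a - δ + 1 + i = 2 ^ a - (δ - 1 - i) by omega,
    show 2 ^ b - 1 - (2 ^ a - 1 - (2 ^ a - δ)) + 1 + i = 2 ^ b - (δ - 1 - i) by omega,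
    pdChar_two_pow_sub (by omega) (by omega), pdChar_two_pow_sub (by omega) (by omega)]

/-! ### Greedy parsings of the infinite period-doubling word -/

/-- The phrases of the parsing whose phrase ends are listed in decreasing order. -/
def phrases : List ℕ → List (List Bool)
  | n :: p :: l => phrases (p :: l) ++ [seg p n]
  | _ => []

theorem length_phrases : ∀ l, (phrases l).length = l.length - 1
  | [] => rfl
  | [_] => rfl
  | n :: p :: l => by simp [phrases, length_phrases (p :: l)]

/-- `Parse Source l` says that the greedy parsing of the infinite period-doubling word, with
respect to the admissible sources `Source`, has the phrase ends `l` (in decreasing order). -/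
inductive Parse (Source : List (List Bool) → List Bool → Prop) : List ℕ → Prop
  | start : Parse Source [0]
  | step {n p : ℕ} {l : List ℕ} (h : Parse Source (p :: l)) (hlt : p < n)
      (hs : Source (phrases (p :: l)) (seg p (n - 1)))
      (hmax : ∀ n' ≥ n, ¬ Source (phrases (p :: l)) (seg p n')) : Parse Source (n :: p :: l)

section Parse

variable {Source : List (List Bool) → List Bool → Prop}

theorem Parse.flatten {l : List ℕ} (h : Parse Source l) :
    ∀ n ∈ l.head?, (phrases l).flatten = seg 0 n := by
  induction h with
  | start => simp [phrases]
  | @step n p l h hlt hs hmax ih =>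
    have := ih p (by simp)
    simp [phrases, this, seg_append (Nat.zero_le p) hlt.le]

theorem Parse.pairwise {l : List ℕ} (h : Parse Source l) : l.Pairwise (· > ·) := by
  induction h with
  | start => simp
  | @step n p l h hlt hs hmax ih =>
    rw [List.pairwise_cons]
    refine ⟨fun e he => ?_, ih⟩
    rcases List.mem_cons.1 he with rfl | he
    · exact hlt
    · exact ((List.pairwise_cons.1 ih).1 e he).trans hlt

/-- `Parse` grows at the right end, whereas the greedy condition concerns the text to the right of a
phrase. Quantifying over the tail lets the induction move phrases into it one by one. -/
theorem Parse.isGreedy_append {l : List ℕ} (h : Parse Source l) :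
    ∀ n ∈ l.head?, ∀ W ≥ n, ∀ tail : List (List Bool), tail.flatten = seg n W →
      (∀ pre x post, tail = pre ++ x :: post → x ≠ [] ∧
        (IsLongestPrefix (Source (phrases l ++ pre)) (x ++ post.flatten) x.dropLast ∨
          (post = [] ∧ Source (phrases l ++ pre) x))) →
      ∀ pre x post, phrases l ++ tail = pre ++ x :: post → x ≠ [] ∧
        (IsLongestPrefix (Source pre) (x ++ post.flatten) x.dropLast ∨
          (post = [] ∧ Source pre x)) := by
  induction h with
  | start =>
    intro n hn W hW tail ht hc
    simpa [phrases] using hc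
  | @step n p l h hlt hs hmax ih =>
    intro n' hn' W hW tail ht hc
    obtain rfl : n = n' := by simpa using hn'
    have e : phrases (n :: p :: l) ++ tail = phrases (p :: l) ++ (seg p n :: tail) := by
      simp [phrases]
    rw [e]
    have ht' : seg p n ++ tail.flatten = seg p W := by rw [ht, seg_append hlt.le hW]
    refine ih p (by simp) W (by omega) (seg p n :: tail) (by simpa using ht') ?_
    intro pre x post he
    cases pre with
    | nil =>
      simp only [List.nil_append, List.cons.injEq] at he
      obtain ⟨rfl, rfl⟩ := he
      refine ⟨?_, Or.inl ⟨?_, ?_, ?_⟩⟩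
      · rw [← List.length_pos_iff]; simp; omega
      · exact (List.dropLast_prefix _).trans (List.prefix_append _ _)
      · simpa [dropLast_seg hlt] using hs
      · intro v hv hP
        rw [ht'] at hv
        have hv' := eq_seg_of_prefix (by omega) hv
        by_contra hlen
        simp only [List.length_dropLast, length_seg] at hlen
        refine hmax (p + v.length) (by omega) ?_
        rw [← hv']
        simpa using hP
    | cons y pre =>
      simp only [List.cons_append, List.cons.injEq] at he
      obtain ⟨rfl, he⟩ := he
      have := hc pre x post he
      simpa [phrases] using this

theorem Parse.isGreedy {n : ℕ} {l : List ℕ} (h : Parse Source (n :: l)) :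
    IsGreedyFactorization Source (seg 0 n) (phrases (n :: l)) := by
  refine ⟨h.flatten n (by simp), ?_⟩
  simpa using h.isGreedy_append n (by simp) n le_rfl [] (by simp) (by simp)

/-- Covers a parsing cut inside a phrase. If the whole remainder is a source, the exception for last
phrases applies; otherwise it is an ordinary greedy phrase. -/
theorem Parse.isGreedy_last {n W : ℕ} {l : List ℕ} (h : Parse Source (n :: l)) (hW : n < W)
    (hs : Source (phrases (n :: l)) (seg n (W - 1))) :
    IsGreedyFactorization Source (seg 0 W) (phrases (n :: l) ++ [seg n W]) := by
  refine ⟨by simp [h.flatten n (by simp), seg_append (Nat.zero_le n) hW.le], ?_⟩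
  refine h.isGreedy_append n (by simp) W hW.le [seg n W] (by simp) ?_
  intro pre x post he
  cases pre with
  | cons y pre => simp at he
  | nil =>
    simp only [List.nil_append, List.cons.injEq] at he
    obtain ⟨rfl, rfl⟩ := he
    refine ⟨by rw [← List.length_pos_iff]; simp; omega, ?_⟩
    simp only [List.append_nil, List.flatten_nil, true_and]
    by_cases hx : Source (phrases (n :: l)) (seg n W)
    · exact Or.inr hx
    · refine Or.inl ⟨List.dropLast_prefix _, by rwa [dropLast_seg hW], ?_⟩
      intro v hv hP
      by_contra hlen
      have hl := hv.length_le
      simp only [List.length_dropLast, length_seg] at hlen hl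
      have := hv.eq_of_length (by simp; omega)
      exact hx (this ▸ hP)

end Parse

/-! ### The LZ77 factorization of the period-doubling sequences -/

theorem parse_lz77 (k : ℕ) : ∃ l, Parse LZ77Source (2 ^ k :: l) ∧ l.length = k + 1 := by
  induction k with
  | zero =>
    refine ⟨[0], .step .start (by norm_num) (by simp [LZ77Source]) ?_, rfl⟩
    intro n hn h
    have := congrArg List.length (List.infix_nil.1 h)
    simp at this
    omega
  | succ k ih =>
    obtain ⟨l, h, hl⟩ := ih
    have hpos : 0 < 2 ^ k := by positivity
    have e2 : 2 ^ (k + 1) = 2 ^ k + 2 ^ k := by ring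
    have hf := h.flatten (2 ^ k) (by simp)
    refine ⟨2 ^ k :: l, .step h (by omega) ?_ ?_, by simp [hl]⟩
    · have e : seg (2 ^ k) (2 ^ (k + 1) - 1) = seg 0 (2 ^ k - 1) := by
        rw [seg_eq_seg (by omega)]
        intro i hi
        rw [show 2 ^ k + 1 + i = 0 + 1 + i + 2 ^ k by omega,
          pdChar_add_two_pow (Nat.not_dvd_of_pos_of_lt (by omega) (by omega))]
      rw [LZ77Source, hf, e]
      exact (seg_prefix (by omega) (by omega)).isInfix
    · intro n hn h'
      rw [LZ77Source, hf] at h'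
      have hlen := h'.length_le
      simp only [length_seg] at hlen
      -- A source is no longer than the parsed text, so it would be all of it; the last letters then
      -- have valuations k + 1 and k.
      obtain rfl : n = 2 ^ k + 2 ^ k := by omega
      have he := h'.eq_of_length (by simp)
      rw [seg_eq_seg (by omega)] at he
      have := he (2 ^ k - 1) (by omega)
      rw [show 2 ^ k + 1 + (2 ^ k - 1) = 2 ^ (k + 1) * 1 by omega,
        show 0 + 1 + (2 ^ k - 1) = 2 ^ k * 1 by omega, pdChar_two_pow_mul _ rfl,
        pdChar_two_pow_mul _ rfl] at this
      simp [Nat.even_add_one, ← Nat.not_even_iff_odd] at this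

theorem numLZ77_periodDoubling (k : ℕ) : numLZ77 (periodDoubling k) = k + 1 := by
  obtain ⟨l, h, hl⟩ := parse_lz77 k
  rw [numLZ77, periodDoubling_eq_seg, lz77_eq_iff.2 h.isGreedy, length_phrases]
  simpa using hl

/-! ### The LZ-End parsing of the infinite period-doubling word -/

theorem lzEndSource_append_singleton {α : Type*} (p : List (List α)) (x u : List α) :
    LZEndSource (p ++ [x]) u ↔ u <:+ (p ++ [x]).flatten ∨ LZEndSource p u := by
  constructor
  · rintro ⟨j, hj, h⟩
    simp only [List.length_append, List.length_singleton] at hj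
    rcases Nat.lt_or_ge p.length j with h1 | h1
    · left
      rwa [List.take_of_length_le (by simp; omega)] at h
    · right
      refine ⟨j, h1, ?_⟩
      rwa [List.take_append_of_le_length h1] at h
  · rintro (h | ⟨j, hj, h⟩)
    · exact ⟨(p ++ [x]).length, le_rfl, by rwa [List.take_length]⟩
    · refine ⟨j, by simp; omega, ?_⟩
      rwa [List.take_append_of_le_length hj]

theorem Parse.lzEndSource_iff {Source : List (List Bool) → List Bool → Prop} {l : List ℕ}
    (h : Parse Source l) (p n : ℕ) :
    LZEndSource (phrases l) (seg p n) ↔ ∃ e ∈ l, Match p n e := by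
  simp only [← seg_suffix_iff]
  induction h with
  | start => simp [phrases, LZEndSource]
  | @step n' p' l h hlt hs hmax ih =>
    have hf := (Parse.step h hlt hs hmax).flatten n' (by simp)
    rw [phrases] at hf ⊢
    rw [lzEndSource_append_singleton, hf, ih]
    simp

theorem Parse.lzEnd_step {n p : ℕ} {l : List ℕ} (h : Parse LZEndSource (p :: l)) (hlt : p < n)
    (hs : ∃ e ∈ p :: l, Match p (n - 1) e)
    (hmax : ∀ n' ≥ n, ∀ e ∈ p :: l, ¬ Match p n' e) : Parse LZEndSource (n :: p :: l) := by
  refine .step h hlt ((h.lzEndSource_iff _ _).2 hs) fun n' hn' h' => ?_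
  obtain ⟨e, he, hm⟩ := (h.lzEndSource_iff _ _).1 h'
  exact hmax n' hn' e he hm

theorem Parse.numLZEnd_eq {k : ℕ} {l : List ℕ} (h : Parse LZEndSource (2 ^ k :: l)) :
    numLZEnd (periodDoubling k) = l.length := by
  rw [numLZEnd, periodDoubling_eq_seg, lzEnd_eq_iff.2 h.isGreedy, length_phrases]
  simp

theorem Parse.numLZEnd_eq_of_match {k n : ℕ} {l : List ℕ} (h : Parse LZEndSource (n :: l))
    (hk : n < 2 ^ k) (hs : ∃ e ∈ n :: l, Match n (2 ^ k - 1) e) :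
    numLZEnd (periodDoubling k) = l.length + 1 := by
  rw [numLZEnd, periodDoubling_eq_seg,
    lzEnd_eq_iff.2 (h.isGreedy_last hk ((h.lzEndSource_iff _ _).2 hs)), List.length_append,
    length_phrases]
  simp

/-! ### Initial LZ-End phrases by computation -/

theorem match_iff_of_le {k p n e : ℕ} (hp : p ≤ n) (hn : n ≤ 2 ^ k) (he : e ≤ 2 ^ k) :
    Match p n e ↔
      ((periodDoubling k).take n).drop p <:+ (periodDoubling k).take e := by
  have h : ∀ m ≤ 2 ^ k, (periodDoubling k).take m = seg 0 m := by
    intro m hm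
    rw [periodDoubling_eq_seg]
    have := (List.prefix_iff_eq_take.1 (seg_prefix (Nat.zero_le m) hm)).symm
    simpa using this
  rw [h n hn, h e he, ← seg_suffix_iff, ← seg_append (Nat.zero_le p) hp,
    List.drop_left' (by simp)]

/-- A match from p has length at most e ≤ p ≤ 16, hence ends by 32: maximality is a finite check
inside S_5. -/
theorem Parse.lzEnd_step_of_decide {n p : ℕ} {l : List ℕ} (h : Parse LZEndSource (p :: l))
    (hlt : p < n) (hp : p ≤ 16) (hn : n ≤ 32)
    (hs : ∃ e ∈ p :: l, ((periodDoubling 5).take (n - 1)).drop p <:+ (periodDoubling 5).take e)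
    (hmax : ∀ n' < 33, n ≤ n' → ∀ e ∈ p :: l,
      ¬ ((periodDoubling 5).take n').drop p <:+ (periodDoubling 5).take e) :
    Parse LZEndSource (n :: p :: l) := by
  have hle : ∀ e ∈ p :: l, e ≤ p := by
    intro e he
    rcases List.mem_cons.1 he with rfl | he
    · exact le_rfl
    · exact ((List.pairwise_cons.1 h.pairwise).1 e he).le
  refine h.lzEnd_step hlt ?_ ?_
  · obtain ⟨e, he, hm⟩ := hs
    have := hle e he
    exact ⟨e, he, (match_iff_of_le (k := 5) (by omega) (by omega) (by omega)).2 hm⟩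
  · intro n' hn' e he hm
    have h1 := hle e he
    have h2 := hm.1
    exact hmax n' (by omega) hn' e he
      ((match_iff_of_le (k := 5) (by omega) (by omega) (by omega)).1 hm)

theorem parse_two : Parse LZEndSource [2, 1, 0] :=
  (Parse.start.lzEnd_step_of_decide (n := 1) (by norm_num) (by norm_num) (by norm_num)
    (by decide) (by decide)).lzEnd_step_of_decide (by norm_num) (by norm_num) (by norm_num)
    (by decide) (by decide)

theorem parse_four : Parse LZEndSource [4, 2, 1, 0] :=
  parse_two.lzEnd_step_of_decide (by norm_num) (by norm_num) (by norm_num) (by decide) (by decide)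

theorem parse_seven : Parse LZEndSource [7, 4, 2, 1, 0] :=
  parse_four.lzEnd_step_of_decide (by norm_num) (by norm_num) (by norm_num) (by decide) (by decide)

theorem parse_sixteen : Parse LZEndSource [16, 10, 7, 4, 2, 1, 0] :=
  (parse_seven.lzEnd_step_of_decide (n := 10) (by norm_num) (by norm_num) (by norm_num)
    (by decide) (by decide)).lzEnd_step_of_decide (by norm_num) (by norm_num) (by norm_num)
    (by decide) (by decide)

theorem numLZEnd_one : numLZEnd (periodDoubling 1) = 2 :=
  Parse.numLZEnd_eq (k := 1) parse_two

theorem numLZEnd_two : numLZEnd (periodDoubling 2) = 3 :=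
  Parse.numLZEnd_eq (k := 2) parse_four

theorem numLZEnd_three : numLZEnd (periodDoubling 3) = 5 :=
  -- The last phrase is the single letter at position 8, with empty source.
  Parse.numLZEnd_eq_of_match (k := 3) parse_seven (by norm_num) ⟨0, by simp, by simp [Match]⟩

/-- The phrase ends after a phrase end `2 ^ (m + 3)`: for `t = s + 1`, the phrase end closest to
`2 ^ (m + 3 + t)` misses it by `3 * 2 ^ m - t`. -/
theorem parse_epoch {m : ℕ} {l : List ℕ} (h : Parse LZEndSource (8 * 2 ^ m :: 5 * 2 ^ m :: l))
    (s : ℕ) (hs : s < 3 * 2 ^ m) :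
    ∃ x y l', Parse LZEndSource ((16 * 2 ^ (m + s) - (3 * 2 ^ m - s - 1)) :: x :: y :: l') ∧
      l'.length = l.length + 2 * s ∧ (∀ e ∈ l, e ∈ l') ∧
      ((s = 0 ∧ x = 8 * 2 ^ m ∧ y = 5 * 2 ^ m) ∨
        (1 ≤ s ∧ x = 10 * 2 ^ (m + s) - (3 * 2 ^ m - s - 1) ∧
          y = 8 * 2 ^ (m + s) - (3 * 2 ^ m - s - 1) - 1)) := by
  induction s with
  | zero =>
    refine ⟨8 * 2 ^ m, 5 * 2 ^ m, l, ?_, by simp, by simp, Or.inl ⟨rfl, rfl, rfl⟩⟩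
    rw [show 16 * 2 ^ (m + 0) - (3 * 2 ^ m - 0 - 1) = 13 * 2 ^ m + 1 by rw [add_zero]; omega]
    refine h.lzEnd_step (by omega) ⟨5 * 2 ^ m, by simp, match_of_pow m⟩ ?_
    intro n hn e he
    refine not_match_of_pow (by omega) ?_
    have hp := h.pairwise
    simp only [List.pairwise_cons, List.mem_cons] at hp he
    rcases he with rfl | rfl | he
    · exact Or.inl rfl
    · exact Or.inr le_rfl
    · exact Or.inr (hp.2.1 e he).le
  | succ s ih =>
    obtain ⟨x, y, l', hP, hl, hmem, hxy⟩ := ih (by omega)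
    have hmono : s = 0 ∧ 2 ^ (m + s) = 2 ^ m ∨ 1 ≤ s ∧ 2 * 2 ^ m ≤ 2 ^ (m + s) := by
      rcases Nat.eq_zero_or_pos s with rfl | h0
      · simp
      · refine Or.inr ⟨h0, ?_⟩
        rw [← pow_succ']
        exact Nat.pow_le_pow_right (by norm_num) (by omega)
    obtain ⟨δ, hδ⟩ : ∃ δ, 3 * 2 ^ m - s - 1 = δ + 1 := ⟨3 * 2 ^ m - s - 2, by omega⟩
    have hδ' : 3 * 2 ^ m - (s + 1) - 1 = δ := by omega
    have hlt : δ + 1 < 3 * 2 ^ (m + s) := by omega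
    have hlt' : 1 ≤ s → δ + 1 < 2 * 2 ^ (m + s) := by omega
    have hU : 2 ^ (m + (s + 1)) = 2 * 2 ^ (m + s) := by rw [← add_assoc, pow_succ']
    rw [hδ] at hP hxy
    rw [hδ', hU]
    have hp := hP.pairwise
    simp only [List.pairwise_cons, List.mem_cons] at hp
    have hP1 : Parse LZEndSource
        ((20 * 2 ^ (m + s) - δ) :: (16 * 2 ^ (m + s) - (δ + 1)) :: x :: y :: l') := by
      refine hP.lzEnd_step (by omega) ⟨_, List.mem_cons_self, ?_⟩ ?_
      · exact match_of_lower (by omega) (by omega)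
      · intro n hn e he
        -- For s = 0 the end 5 * 2^m plus the miss 3 * 2^m - 1 stays just below 8 * 2^m; for s ≥ 1
        -- the value of y gives the same bound.
        refine not_match_of_lower (by omega) hlt (by omega) ?_
        simp only [List.mem_cons] at he
        have h1 := fun he => hp.2.2.1 e he
        rcases he with rfl | rfl | rfl | he
        · omega
        · omega
        · omega
        · have := h1 he
          omega
    refine ⟨20 * 2 ^ (m + s) - δ, 16 * 2 ^ (m + s) - (δ + 1), x :: y :: l', ?_,
      by simp [hl]; ring, fun e he => by simp [hmem e he], Or.inr ⟨by omega, by omega, by omega⟩⟩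
    rw [show 16 * (2 * 2 ^ (m + s)) = 32 * 2 ^ (m + s) by ring]
    refine hP1.lzEnd_step (by omega) ⟨16 * 2 ^ (m + s) - δ - 1, ?_, match_of_upper (by omega)⟩ ?_
    · rw [Nat.sub_sub]; simp
    · intro n hn e he
      refine not_match_of_upper hlt (by omega) ?_
      rcases List.mem_cons.1 he with rfl | he
      · exact Or.inl rfl
      · have hp1 := (List.pairwise_cons.1 hP1.pairwise).2
        rcases List.mem_cons.1 he with rfl | he
        · omega
        · have := (List.pairwise_cons.1 hp1).1 e he
          omega

/-- The numbers `m` such that `2 ^ (m + 3)` is a phrase end of the LZ-End parsing of the infinite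
period-doubling word. -/
def pdEpoch : ℕ → ℕ
  | 0 => 1
  | n + 1 => pdEpoch n + 3 * 2 ^ pdEpoch n

theorem pdEpoch_pos (n : ℕ) : 1 ≤ pdEpoch n := by
  induction n with
  | zero => exact le_rfl
  | succ n ih => exact ih.trans (Nat.le_add_right _ _)

/-- The end 4 * 2^m - 1 is carried along because it supplies the source of the cut last phrase of
S_k throughout the epoch. -/
theorem parse_pdEpoch (n : ℕ) : ∃ l,
    Parse LZEndSource (8 * 2 ^ pdEpoch n :: 5 * 2 ^ pdEpoch n :: l) ∧
      4 * 2 ^ pdEpoch n - 1 ∈ l ∧ l.length + n = 2 * pdEpoch n + 3 := by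
  induction n with
  | zero => exact ⟨[7, 4, 2, 1, 0], parse_sixteen, by simp [pdEpoch], by simp [pdEpoch]⟩
  | succ n ih =>
    obtain ⟨l, h, -, hl⟩ := ih
    have h2 : 2 ^ 1 ≤ 2 ^ pdEpoch n := Nat.pow_le_pow_right (by norm_num) (pdEpoch_pos n)
    -- At this last value of s the miss is 0, so a phrase ends exactly at a power of two.
    obtain ⟨x, y, l', hP, hl', -, hxy⟩ := parse_epoch h (3 * 2 ^ pdEpoch n - 1) (by omega)
    have e : 2 ^ pdEpoch (n + 1) = 2 * 2 ^ (pdEpoch n + (3 * 2 ^ pdEpoch n - 1)) := by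
      rw [← pow_succ', pdEpoch]
      congr 1
      omega
    have e0 : 3 * 2 ^ pdEpoch n - (3 * 2 ^ pdEpoch n - 1) - 1 = 0 := by omega
    rw [e0] at hP hxy
    obtain ⟨-, rfl, rfl⟩ : 1 ≤ 3 * 2 ^ pdEpoch n - 1 ∧ _ := by
      refine hxy.resolve_left ?_
      omega
    rw [e]
    refine ⟨(8 * 2 ^ (pdEpoch n + (3 * 2 ^ pdEpoch n - 1)) - 0 - 1) :: l', ?_, ?_, ?_⟩
    · convert hP using 2
      · omega
      · congr 1
        omega
    · rw [List.mem_cons]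
      omega
    · simp only [List.length_cons, pdEpoch]
      omega

theorem numLZEnd_add (n t : ℕ) (ht : t < 3 * 2 ^ pdEpoch n) :
    numLZEnd (periodDoubling (pdEpoch n + 3 + t)) + (n + 2) = 2 * (pdEpoch n + 3 + t) := by
  obtain ⟨l, h, hm, hl⟩ := parse_pdEpoch n
  have e8 : 8 * 2 ^ pdEpoch n = 2 ^ (pdEpoch n + 3) := by ring
  cases t with
  | zero =>
    rw [e8] at h
    have := h.numLZEnd_eq
    simp only [List.length_cons] at this
    rw [add_zero, this]
    omega
  | succ s =>
    obtain ⟨x, y, l', hP, hl', hmem, -⟩ := parse_epoch h s (by omega)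
    have e4 : 4 * 2 ^ pdEpoch n = 2 ^ (pdEpoch n + 2) := by ring
    have e16 : 16 * 2 ^ (pdEpoch n + s) = 2 ^ (pdEpoch n + 3 + (s + 1)) := by ring
    have hle : 2 ^ (pdEpoch n + 2) ≤ 2 ^ (pdEpoch n + 3 + (s + 1)) :=
      Nat.pow_le_pow_right (by norm_num) (by omega)
    rw [e16] at hP
    -- The remainder before 2^k is shorter than 2^(m+2), m being `pdEpoch n`, so by the palindrome
    -- symmetry all but its last letter is a suffix of the prefix ending at 2^(m+2) - 1.
    have := hP.numLZEnd_eq_of_match (k := pdEpoch n + 3 + (s + 1)) (by omega)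
      ⟨4 * 2 ^ pdEpoch n - 1, by simp [hmem _ hm], by
        rw [e4]
        exact match_two_pow_sub (by omega) (by omega) (by omega)⟩
    simp only [List.length_cons] at this
    rw [this]
    omega

theorem exists_pdEpoch (k : ℕ) (hk : 4 ≤ k) :
    ∃ n t, k = pdEpoch n + 3 + t ∧ t < 3 * 2 ^ pdEpoch n := by
  induction k, hk using Nat.le_induction with
  | base => exact ⟨0, 0, rfl, by simp [pdEpoch]⟩
  | succ k hk ih =>
    obtain ⟨n, t, rfl, ht⟩ := ih
    by_cases h : t + 1 < 3 * 2 ^ pdEpoch n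
    · exact ⟨n, t + 1, rfl, h⟩
    · exact ⟨n + 1, 0, by rw [pdEpoch]; omega, by positivity⟩

/-! ### Comparison with the iterated logarithm -/

theorem two_pow_pdEpoch_le (n : ℕ) : 2 ^ (pdEpoch n + 1) ≤ pdEpoch (n + 1) + 1 := by
  rw [pdEpoch, pow_succ]
  omega

theorem logStar_succ_le {x : ℝ} (hx : 1 < x) : logStar (Real.logb 2 x) + 1 ≤ logStar x := by
  have h := Nat.sInf_mem (logStar_nonempty x)
  change (Real.logb 2)^[logStar x] x ≤ 1 at h
  generalize logStar x = i at h ⊢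
  cases i with
  | zero => exact absurd h (by simpa using hx)
  | succ i => exact Nat.succ_le_succ (Nat.sInf_le (by simpa using h))

/-- By `two_pow_pdEpoch_le`, one binary logarithm takes `pdEpoch (n + 1) + 1` to at least `pdEpoch n
+ 1`. -/
theorem le_logStar (n : ℕ) (x : ℝ) (hx : (pdEpoch n : ℝ) + 1 ≤ x) : n + 1 ≤ logStar x := by
  induction n generalizing x with
  | zero =>
    have h1 : (1 : ℝ) < x := by
      simp only [pdEpoch] at hx
      norm_num at hx
      linarith
    exact le_trans (by omega) (logStar_succ_le h1)
  | succ n ih =>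
    have h1 : (2 : ℝ) ^ (pdEpoch n + 1) ≤ (pdEpoch (n + 1) : ℝ) + 1 := by
      exact_mod_cast two_pow_pdEpoch_le n
    have h2 : (1 : ℝ) < 2 ^ (pdEpoch n + 1) := one_lt_pow₀ (by norm_num) (by omega)
    have h3 : (pdEpoch n : ℝ) + 1 ≤ Real.logb 2 x := by
      rw [Real.le_logb_iff_rpow_le (by norm_num) (by linarith)]
      have : (2 : ℝ) ^ ((pdEpoch n : ℝ) + 1) = 2 ^ (pdEpoch n + 1) := by
        rw [← Real.rpow_natCast]; push_cast; rfl
      rw [this]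
      linarith
    have := ih _ h3
    have := logStar_succ_le (x := x) (by linarith)
    omega

/-- A crude bound on the deficit n + 2; with k at least `pdEpoch n + 3` it yields O(√k), enough for
the ratio. -/
theorem sq_le_pdEpoch (n : ℕ) : (n + 2) ^ 2 ≤ 4 * (pdEpoch n + 3) := by
  have h : ∀ n, n + 1 ≤ pdEpoch n ∧ (n + 2) ^ 2 ≤ 4 * (pdEpoch n + 3) := by
    intro n
    induction n with
    | zero => simp [pdEpoch]
    | succ n ih =>
      have h2 : pdEpoch n < 2 ^ pdEpoch n := Nat.lt_two_pow_self
      rw [pdEpoch]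
      constructor
      · omega
      · nlinarith
  exact (h n).2

/-- The number of LZ-End phrases of the `k`-th period-doubling sequence falls short of `2 * k` by
a number that is at most `2 * logStar k` and at most the square root of `4 * k`. -/
theorem exists_numLZEnd_add (k : ℕ) (hk : 4 ≤ k) : ∃ d,
    numLZEnd (periodDoubling k) + d = 2 * k ∧ d ≤ 2 * logStar k ∧ d ^ 2 ≤ 4 * k := by
  obtain ⟨n, t, rfl, ht⟩ := exists_pdEpoch k hk
  refine ⟨n + 2, numLZEnd_add n t ht, ?_, (sq_le_pdEpoch n).trans (by omega)⟩
  have := le_logStar n ((pdEpoch n + 3 + t : ℕ) : ℝ) (by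
    have : pdEpoch n + 1 ≤ pdEpoch n + 3 + t := by omega
    exact_mod_cast this)
  omega

theorem tendsto_numLZEnd_div_numLZ77 :
    Tendsto (fun k : ℕ => (numLZEnd (periodDoubling k) : ℝ) /
      (numLZ77 (periodDoubling k) : ℝ)) atTop (𝓝 2) := by
  have hlow : Tendsto (fun k : ℕ => 2 - 4 / √((k : ℝ))) atTop (𝓝 2) := by
    have : Tendsto (fun k : ℕ => 4 / √((k : ℝ))) atTop (𝓝 0) :=
      (Real.tendsto_sqrt_atTop.comp tendsto_natCast_atTop_atTop).const_div_atTop 4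
    simpa using this.const_sub 2
  refine tendsto_of_tendsto_of_tendsto_of_le_of_le' hlow tendsto_const_nhds ?_ ?_
  · filter_upwards [eventually_ge_atTop 4] with k hk
    obtain ⟨d, hd, -, hsq⟩ := exists_numLZEnd_add k hk
    rw [numLZ77_periodDoubling]
    have hk' : (4 : ℝ) ≤ k := by exact_mod_cast hk
    have hd' : (numLZEnd (periodDoubling k) : ℝ) + d = 2 * k := by exact_mod_cast hd
    have hsq' : (d : ℝ) ^ 2 ≤ 4 * k := by exact_mod_cast hsq
    have hs : √(k : ℝ) ^ 2 = k := Real.sq_sqrt (by linarith)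
    have h2 : 2 ≤ √(k : ℝ) := Real.le_sqrt_of_sq_le (by linarith)
    have hds : (d : ℝ) ≤ 2 * √(k : ℝ) := by
      refine abs_le_of_sq_le_sq' ?_ (by linarith) |>.2
      nlinarith
    have hq : 4 / √(k : ℝ) * √(k : ℝ) = 4 := div_mul_cancel₀ _ (by linarith)
    have hpos : 0 < 4 / √(k : ℝ) := by positivity
    push_cast
    rw [le_div_iff₀ (by linarith)]
    have h4 : 4 / √(k : ℝ) * k = 4 * √(k : ℝ) := by
      calc 4 / √(k : ℝ) * k = 4 / √(k : ℝ) * √(k : ℝ) * √(k : ℝ) := by rw [mul_assoc, ← sq, hs]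
        _ = 4 * √(k : ℝ) := by rw [hq]
    nlinarith
  · filter_upwards [eventually_ge_atTop 4] with k hk
    obtain ⟨d, hd, -, -⟩ := exists_numLZEnd_add k hk
    rw [numLZ77_periodDoubling, div_le_iff₀ (by positivity)]
    have : numLZEnd (periodDoubling k) ≤ 2 * (k + 1) := by omega
    exact_mod_cast this

theorem exists_deficit : ∃ f : ℕ → ℕ,
    (∀ k : ℕ, 1 ≤ k → numLZEnd (periodDoubling k) + f k = 2 * k) ∧
      (fun k : ℕ => (f k : ℝ)) =O[atTop] (fun k : ℕ => (logStar (k : ℝ) : ℝ)) := by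
  refine ⟨fun k => 2 * k - numLZEnd (periodDoubling k), fun k hk => ?_, ?_⟩
  · beta_reduce
    rcases Nat.lt_or_ge k 4 with h4 | h4
    · interval_cases k
      · rw [numLZEnd_one]
      · rw [numLZEnd_two]
      · rw [numLZEnd_three]
    · obtain ⟨d, hd, -, -⟩ := exists_numLZEnd_add k h4
      omega
  · refine IsBigO.of_bound 2 ?_
    filter_upwards [eventually_ge_atTop 4] with k hk
    obtain ⟨d, hd, hlog, -⟩ := exists_numLZEnd_add k hk
    rw [Real.norm_natCast, Real.norm_natCast]
    have : 2 * k - numLZEnd (periodDoubling k) ≤ 2 * logStar k := by omega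
    exact_mod_cast this

/-! ### Unary strings -/

section Unary

variable {α : Type*}

theorem LZEndSource.lz77Source {pre : List (List α)} {u : List α} (h : LZEndSource pre u) :
    LZ77Source pre u := by
  obtain ⟨j, -, h⟩ := h
  exact h.isInfix.trans ((List.take_prefix j pre).flatten).isInfix

/-- A unary factor is a suffix of the whole parsed text, so j can be the number of all phrases
parsed. -/
theorem lzEndSource_iff_of_unary {pre : List (List α)} {c : α} (h : ∀ x ∈ pre.flatten, x = c)
    (u : List α) : LZEndSource pre u ↔ LZ77Source pre u := by
  refine ⟨LZEndSource.lz77Source, fun hu => ⟨pre.length, le_rfl, ?_⟩⟩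
  rw [List.take_length]
  have h1 := List.eq_replicate_of_mem h
  have h2 := List.eq_replicate_of_mem (fun x hx => h x (hu.subset hx))
  have hl := hu.length_le
  rw [h1, h2]
  exact ⟨List.replicate (pre.flatten.length - u.length) c, by
    rw [List.replicate_append_replicate]; congr 1; omega⟩

theorem lz77_replicate (c : α) (n : ℕ) :
    lz77 (List.replicate n c) = lzEnd (List.replicate n c) := by
  rw [lz77_eq_iff]
  have h := lzEnd_eq_iff.1 (rfl : lzEnd (List.replicate n c) = _)
  refine ⟨h.1, fun pre x post hp => ?_⟩
  have hpre : ∀ y ∈ pre.flatten, y = c := by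
    intro y hy
    have h1 := h.1
    rw [hp, List.flatten_append] at h1
    exact List.eq_of_mem_replicate (h1 ▸ List.mem_append_left _ hy)
  have := h.2 pre x post hp
  simpa only [IsLongestPrefix, lzEndSource_iff_of_unary hpre] using this

theorem not_tendsto_of_unary (w : ℕ → List α)
    (hw : ∀ m, ∃ (c : α) (n : ℕ), w m = List.replicate n c) :
    ¬ Tendsto (fun m : ℕ => (numLZEnd (w m) : ℝ) / (numLZ77 (w m) : ℝ)) atTop (𝓝 2) := by
  intro h
  have hle : ∀ m, (numLZEnd (w m) : ℝ) / (numLZ77 (w m) : ℝ) ≤ 1 := by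
    intro m
    obtain ⟨c, n, hm⟩ := hw m
    rw [hm, numLZEnd, numLZ77, lz77_replicate]
    exact div_self_le_one _
  have := le_of_tendsto' h hle
  norm_num at this

end Unary

end LZ

theorem corollary1 :
    -- the LZ77 count of the period-doubling sequences
    (∀ k : ℕ, LZ.numLZ77 (LZ.periodDoubling k) = k + 1) ∧
    -- the LZ-End count of the period-doubling sequences: `2 k - f k` with `f k = O(log* k)`
    (∃ f : ℕ → ℕ,
      (∀ k : ℕ, 1 ≤ k → LZ.numLZEnd (LZ.periodDoubling k) + f k = 2 * k) ∧
      (fun k : ℕ => (f k : ℝ)) =O[atTop] (fun k : ℕ => (LZ.logStar (k : ℝ) : ℝ))) ∧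
    -- the ratio tends to 2 along this family of binary strings
    Tendsto (fun k : ℕ => (LZ.numLZEnd (LZ.periodDoubling k) : ℝ) /
      (LZ.numLZ77 (LZ.periodDoubling k) : ℝ)) atTop (𝓝 2) ∧
    -- on unary strings the two factorizations coincide
    (∀ (α : Type*) (c : α) (n : ℕ),
      LZ.lz77 (List.replicate n c) = LZ.lzEnd (List.replicate n c)) ∧
    -- so no family of unary strings has a ratio that tends to 2
    (∀ (α : Type*) (w : ℕ → List α), (∀ m, ∃ (c : α) (n : ℕ), w m = List.replicate n c) →
      ¬ Tendsto (fun m : ℕ => (LZ.numLZEnd (w m) : ℝ) / (LZ.numLZ77 (w m) : ℝ)) atTop (𝓝 2)) := by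
  exact ⟨LZ.numLZ77_periodDoubling, LZ.exists_deficit, LZ.tendsto_numLZEnd_div_numLZ77,
    fun _ c n => LZ.lz77_replicate c n, fun _ w hw => LZ.not_tendsto_of_unary w hw⟩
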